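/- Let $\Gamma$ be an infinite group generated by a finite set $X$, and let $G$ be the Cayley graph of $(\Gamma,X)$: the unoriented graph with vertex set $\Gamma$ and edges $[g,gx]$ for $g\in\Gamma$, $x\in X$. Let $d_G$ be the graph distance in $G$, and for $o\in\Gamma$ and $r>0$ let $B(o,r):=\{v\in\Gamma: d_G(o,v)\le r\}$. Let $S=(S_0,S_1,\dots)$ be a random walk on $\Gamma$ with $S_0=o$ almost surely, that is, the increments $S_{t-1}^{-1}S_t$ ($t\ge1$) are independent and identically distributed. Assume that $S$ is symmetric, i.e. $\mathbb P[S_0^{-1}S_1=g]=\mathbb P[S_0^{-1}S_1=g^{-1}]$ for all $g\in\Gamma$, and that the support $\{g:\mathbb P[S_0^{-1}S_1=g]>0\}$ of the step distribution (which may be infinite) generates $\Gamma$. Let $\tau_r:=\inf\{t\ge0: S_t\notin B(o,r)\}$ be the first exit time of $B(o,r)$. Then there is a constant $c>0$ such that $\mathbb E[\tau_r]\le c\,r^2$ for all real $r\ge1$. -/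

import Mathlib

open MeasureTheory ProbabilityTheory
open scoped ENNReal

noncomputable section

namespace CayleyWalk

/-- The closed ball `B(o, r) = {v : d_G(o, v) ≤ r}` for the graph distance of the Cayley graph `G`
of `(Γ, X)`, whose edges are the pairs `[g, g * x]` with `x ∈ X`. -/
def ball {Γ : Type*} [Group Γ] (X : Set Γ) (o : Γ) (r : ℝ) : Set Γ :=
  {v | ((SimpleGraph.mulCayley X).dist o v : ℝ) ≤ r}

/-- The increment `S_t⁻¹ S_{t+1}`. -/
def increment {Γ Ω : Type*} [Group Γ] (S : ℕ → Ω → Γ) (t : ℕ) (ω : Ω) : Γ :=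
  (S t ω)⁻¹ * S (t + 1) ω

/-- `S` is a random walk on `Γ` started at `o`: its increments are independent and identically
distributed, and `S_0 = o` almost surely. -/
structure IsRandomWalk {Γ Ω : Type*} [Group Γ] [MeasurableSpace Γ] [MeasurableSpace Ω]
    (P : Measure Ω) (S : ℕ → Ω → Γ) (o : Γ) : Prop where
  measurable : ∀ t, Measurable (S t)
  start : ∀ᵐ ω ∂P, S 0 ω = o
  indep : iIndepFun (increment S) P
  identDistrib : ∀ t, IdentDistrib (increment S t) (increment S 0) P P

/-- The walk is symmetric: `P[S_0⁻¹ S_1 = g] = P[S_0⁻¹ S_1 = g⁻¹]` for all `g`. -/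
def IsSymmetric {Γ Ω : Type*} [Group Γ] [MeasurableSpace Ω]
    (P : Measure Ω) (S : ℕ → Ω → Γ) : Prop :=
  ∀ g : Γ, P {ω | increment S 0 ω = g} = P {ω | increment S 0 ω = g⁻¹}

/-- The support of the step distribution. -/
def stepSupport {Γ Ω : Type*} [Group Γ] [MeasurableSpace Ω]
    (P : Measure Ω) (S : ℕ → Ω → Γ) : Set Γ :=
  {g | P {ω | increment S 0 ω = g} ≠ 0}

/-- The first exit time `τ_r = inf {t : S_t ∉ B(o, r)}`, equal to `∞` if the walk never exits. -/
def exitTime {Γ Ω : Type*} [Group Γ] (X : Set Γ) (S : ℕ → Ω → Γ) (o : Γ) (r : ℝ) (ω : Ω) : ℕ∞ :=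
  hittingAfter S (ball X o r)ᶜ 0 ω

end CayleyWalk

end

/-! Write p for the step law and T for a finite symmetric generating set containing 1. The expected
exit time is at most the sum over t of the probability of staying in the ball up to time t, so it
suffices to bound the lifetime of the walk killed outside `T ^ n`. No moment of p is assumed, so all
energies are truncated to steps in `T ^ k`. The proof splits on the regular representation on ℓ²(Γ).

If some truncated energy has a spectral gap, the ℓ² norm of the killed law decays geometrically.
Cauchy-Schwarz against the at most exponential volume then gives a linear bound.

Otherwise, for every k the truncated Laplacian has approximately harmonic f
(`exists_norm_sq_le_mul_inner`). With E the energy of f, the orbit map g ↦ π g f is C√E-Lipschitz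
for the word metric, with C independent of k, and ‖π y f - f‖² gains at least E/2 on average per
truncated step (`sum_mul_norm_map_sub_sq_ge`). It is O(n²E) on the relevant balls, so the lifetime
is O(n²). -/

namespace CayleyWalk

open scoped Pointwise RealInnerProductSpace

/-! ### Positive operators without a spectral gap -/

/-- If a positive self-adjoint injective operator has no spectral gap at `0`, then it has
approximately harmonic vectors, normalised by their energy. -/
theorem exists_norm_sq_le_mul_inner {H : Type*} [NormedAddCommGroup H] [InnerProductSpace ℝ H]
    [CompleteSpace H] (A : H →L[ℝ] H) (hsa : ∀ u v, ⟪A u, v⟫ = ⟪u, A v⟫)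
    (hpos : ∀ u, 0 ≤ ⟪u, A u⟫) (hinj : ∀ u, A u = 0 → u = 0)
    (hgap : ∀ δ > 0, ∃ u, ⟪u, A u⟫ < δ * ‖u‖ ^ 2) {ε : ℝ} (hε : 0 < ε) :
    ∃ u, 0 < ⟪u, A u⟫ ∧ ‖A u‖ ^ 2 ≤ ε * ⟪u, A u⟫ := by
  by_contra! hcon
  have hA : ∀ u, ε * ⟪u, A u⟫ ≤ ‖A u‖ ^ 2 := fun u ↦ by
    rcases (hpos u).eq_or_lt with h | h
    · rw [← h, mul_zero]; positivity
    · exact (hcon u h).le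
  -- Positivity of A at εh - Ah, combined with A² ≥ εA, gives the gap A ≥ ε on the range of A,
  -- without the spectral theorem.
  have hrange : ∀ h, ε * ‖A h‖ ^ 2 ≤ ⟪A h, A (A h)⟫ := fun h ↦ by
    have h1 := hpos (ε • h - A h)
    have h2 : ⟪ε • h - A h, A (ε • h - A h)⟫
        = ε * (ε * ⟪h, A h⟫) - 2 * (ε * ‖A h‖ ^ 2) + ⟪A h, A (A h)⟫ := by
      have h3 : ⟪h, A (A h)⟫ = ‖A h‖ ^ 2 := by rw [← hsa, real_inner_self_eq_norm_sq]
      simp only [map_sub, map_smul, inner_sub_left, inner_sub_right, real_inner_smul_left,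
        real_inner_smul_right, h3, real_inner_self_eq_norm_sq]
      ring
    nlinarith [mul_le_mul_of_nonneg_left (hA h) hε.le]
  have hdense : DenseRange A := by
    have hbot : (A.range)ᗮ = ⊥ := by
      rw [eq_bot_iff]
      intro u hu
      rw [Submodule.mem_bot]
      refine hinj u (ext_inner_right ℝ fun v ↦ ?_)
      rw [hsa, inner_zero_left, real_inner_comm]
      exact hu (A v) ⟨v, rfl⟩
    have := Submodule.topologicalClosure_eq_top_iff.2 hbot
    exact Submodule.dense_iff_topologicalClosure_eq_top.2 this
  obtain ⟨u, hu⟩ := hgap ε hε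
  refine absurd hu (not_lt.2 ?_)
  refine hdense.induction_on (p := fun u ↦ ε * ‖u‖ ^ 2 ≤ ⟪u, A u⟫) u ?_ hrange
  exact isClosed_le (by fun_prop) (by fun_prop)

/-! ### Energy and Laplacian of a unitary representation -/

section Representation

variable {Γ H : Type*} [Group Γ] [NormedAddCommGroup H] [InnerProductSpace ℝ H]
  (π : Γ →* (H ≃ₗᵢ[ℝ] H)) (p : Γ → ℝ)

theorem map_mul_apply (a b : Γ) (f : H) : π (a * b) f = π a (π b f) := by
  rw [map_mul]; rfl

/-- The energy of the orbit map of `f`, for the steps in `s` weighted by `p`. -/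
def energy (s : Finset Γ) (f : H) : ℝ := ∑ g ∈ s, p g * ‖π g f - f‖ ^ 2

/-- The Laplacian of the steps in `s` weighted by `p`. -/
def laplacian (s : Finset Γ) : H →L[ℝ] H :=
  ∑ g ∈ s, p g • (ContinuousLinearMap.id ℝ H - ((π g).toContinuousLinearEquiv : H →L[ℝ] H))

theorem laplacian_apply (s : Finset Γ) (f : H) :
    laplacian π p s f = ∑ g ∈ s, p g • (f - π g f) := by
  simp [laplacian]

theorem inner_laplacian (s : Finset Γ) (f : H) :
    ⟪f, laplacian π p s f⟫ = energy π p s f / 2 := by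
  rw [laplacian_apply, inner_sum, energy, Finset.sum_div]
  refine Finset.sum_congr rfl fun g _ ↦ ?_
  rw [real_inner_smul_right, inner_sub_right, norm_sub_sq_real, LinearIsometryEquiv.norm_map,
    real_inner_self_eq_norm_sq, real_inner_comm]
  ring

theorem inner_laplacian_comm [DecidableEq Γ] (hp : ∀ g, p g⁻¹ = p g) {s : Finset Γ}
    (hs : s⁻¹ = s) (u v : H) : ⟪laplacian π p s u, v⟫ = ⟪u, laplacian π p s v⟫ := by
  rw [laplacian_apply, laplacian_apply, inner_sum, sum_inner]
  conv_rhs => rw [← hs, Finset.sum_inv_index]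
  refine Finset.sum_congr rfl fun g _ ↦ ?_
  rw [real_inner_smul_right, real_inner_smul_left, hp, inner_sub_left, inner_sub_right]
  congr 2
  rw [← (π g).inner_map_map u, ← map_mul_apply]
  simp

variable {π p}

theorem energy_nonneg (hp : ∀ g, 0 ≤ p g) (s : Finset Γ) (f : H) : 0 ≤ energy π p s f :=
  Finset.sum_nonneg fun g _ ↦ mul_nonneg (hp g) (sq_nonneg _)

theorem energy_mono (hp : ∀ g, 0 ≤ p g) {s t : Finset Γ} (h : s ⊆ t) (f : H) :
    energy π p s f ≤ energy π p t f :=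
  Finset.sum_le_sum_of_subset_of_nonneg h fun g _ _ ↦ mul_nonneg (hp g) (sq_nonneg _)

theorem norm_map_mul_sub_le (a b : Γ) (f : H) :
    ‖π (a * b) f - f‖ ≤ ‖π a f - f‖ + ‖π b f - f‖ := by
  have : π (a * b) f - f = π a (π b f - f) + (π a f - f) := by
    rw [map_mul_apply, map_sub]; abel
  rw [this, add_comm ‖π a f - f‖]
  refine (norm_add_le _ _).trans ?_
  rw [LinearIsometryEquiv.norm_map]

theorem norm_map_inv_sub (a : Γ) (f : H) : ‖π a⁻¹ f - f‖ = ‖π a f - f‖ := by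
  rw [← (π a).norm_map, map_sub, ← map_mul_apply, norm_sub_rev]
  simp

theorem norm_map_sub_le_of_mem_pow [DecidableEq Γ] {T : Finset Γ} {f : H} {M : ℝ}
    (hM : ∀ s ∈ T, ‖π s f - f‖ ≤ M) (n : ℕ) : ∀ g ∈ T ^ n, ‖π g f - f‖ ≤ n * M := by
  induction n with
  | zero => intro g hg; simp_all
  | succ n ih =>
    intro g hg
    rw [pow_succ, Finset.mem_mul] at hg
    obtain ⟨a, ha, b, hb, rfl⟩ := hg
    have := norm_map_mul_sub_le (π := π) a b f
    push_cast
    linarith [ih a ha, hM b hb]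

/-- Displacements are bounded by the energy, uniformly in the range of the steps. -/
theorem exists_norm_map_sub_le_sqrt_energy [DecidableEq Γ] {T : Finset Γ} (h1 : 1 ∈ T)
    (hT : ∀ g, ∃ n : ℕ, g ∈ T ^ n) (hp : ∀ g, 0 ≤ p g)
    (hgen : Subgroup.closure {g | p g ≠ 0} = ⊤) (s : Γ) :
    ∃ C : ℝ, 0 ≤ C ∧ ∃ N : ℕ, ∀ k ≥ N, ∀ f : H,
      ‖π s f - f‖ ≤ C * √(energy π p (T ^ k) f) := by
  have hs : s ∈ Subgroup.closure {g | p g ≠ 0} := hgen ▸ Subgroup.mem_top s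
  induction hs using Subgroup.closure_induction with
  | mem g hg =>
    obtain ⟨N, hN⟩ := hT g
    have hpg : 0 < p g := (hp g).lt_of_ne' hg
    refine ⟨√(1 / p g), by positivity, N, fun k hk f ↦ ?_⟩
    rw [← Real.sqrt_mul (by positivity)]
    refine Real.le_sqrt_of_sq_le ?_
    rw [one_div, ← div_eq_inv_mul, le_div_iff₀ hpg, mul_comm]
    -- A support element is controlled by its own term of the energy, which is present once g lies
    -- in `T ^ k`.
    exact Finset.single_le_sum (f := fun g ↦ p g * ‖π g f - f‖ ^ 2)
      (fun g _ ↦ mul_nonneg (hp g) (sq_nonneg _)) (Finset.pow_subset_pow_right h1 hk hN)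
  | one => exact ⟨0, le_rfl, 0, fun k _ f ↦ by simp⟩
  | mul a b _ _ iha ihb =>
    obtain ⟨C, hC, N, h⟩ := iha
    obtain ⟨C', hC', N', h'⟩ := ihb
    refine ⟨C + C', by positivity, max N N', fun k hk f ↦ ?_⟩
    have := norm_map_mul_sub_le (π := π) a b f
    rw [add_mul]
    linarith [h k (le_of_max_le_left hk) f, h' k (le_of_max_le_right hk) f]
  | inv a _ ih =>
    obtain ⟨C, hC, N, h⟩ := ih
    exact ⟨C, hC, N, fun k hk f ↦ by rw [norm_map_inv_sub]; exact h k hk f⟩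

theorem exists_forall_norm_map_sub_le_sqrt_energy [DecidableEq Γ] {T : Finset Γ} (h1 : 1 ∈ T)
    (hT : ∀ g, ∃ n : ℕ, g ∈ T ^ n) (hp : ∀ g, 0 ≤ p g)
    (hgen : Subgroup.closure {g | p g ≠ 0} = ⊤) :
    ∃ C : ℝ, 0 < C ∧ ∃ N : ℕ, ∀ k ≥ N, ∀ f : H, ∀ s ∈ T,
      ‖π s f - f‖ ≤ C * √(energy π p (T ^ k) f) := by
  choose C hC N h using exists_norm_map_sub_le_sqrt_energy (π := π) h1 hT hp hgen
  refine ⟨1 + ∑ s ∈ T, C s, by linarith [Finset.sum_nonneg fun s (_ : s ∈ T) ↦ hC s],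
    T.sup N, fun k hk f s hs ↦ ?_⟩
  refine (h s k ((Finset.le_sup hs).trans hk) f).trans ?_
  gcongr
  linarith [Finset.single_le_sum (fun s _ ↦ hC s) hs]

/-- The displacement of an approximately harmonic vector grows by half its energy in each step. -/
theorem sum_mul_norm_map_sub_sq_ge {f : H} {D : ℝ} {s : Finset Γ} {y : Γ}
    (hy : ‖π y f - f‖ ≤ D) (hD : 4 * D * ‖laplacian π p s f‖ ≤ energy π p s f) :
    (∑ g ∈ s, p g) * ‖π y f - f‖ ^ 2 + energy π p s f / 2
      ≤ ∑ g ∈ s, p g * ‖π (y * g) f - f‖ ^ 2 := by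
  -- The cross terms sum to one pairing with the Laplacian of f, so they cost at most 2D‖Δf‖ ≤ E/2.
  have key : ∑ g ∈ s, p g * ‖π (y * g) f - f‖ ^ 2 = (∑ g ∈ s, p g) * ‖π y f - f‖ ^ 2
      + energy π p s f - 2 * ⟪π y f - f, π y (laplacian π p s f)⟫ := by
    rw [laplacian_apply, map_sum, inner_sum, energy, Finset.mul_sum, Finset.sum_mul,
      ← Finset.sum_add_distrib, ← Finset.sum_sub_distrib]
    refine Finset.sum_congr rfl fun g _ ↦ ?_
    have : π (y * g) f - f = (π y f - f) - π y (f - π g f) := by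
      rw [map_mul_apply, map_sub]; abel
    rw [this, norm_sub_sq_real, LinearIsometryEquiv.norm_map, map_smul, real_inner_smul_right,
      norm_sub_rev f]
    ring
  have h1 := real_inner_le_norm (π y f - f) (π y (laplacian π p s f))
  rw [LinearIsometryEquiv.norm_map] at h1
  have h2 := mul_le_mul_of_nonneg_right hy (norm_nonneg (laplacian π p s f))
  rw [key]
  linarith

end Representation

/-! ### The regular representation and the killed quadratic form -/

section RegularRepresentation

variable (Γ : Type*) [Group Γ]

/-- The space of square-summable real functions on `Γ`. -/
abbrev L2 : Type _ := lp (fun _ : Γ ↦ ℝ) 2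

variable {Γ}

theorem memlp_comp_equiv {Γ : Type*} (e : Γ ≃ Γ) (f : L2 Γ) : Memℓp (fun x ↦ f (e x)) 2 := by
  have := (lp.memℓp f).summable (by norm_num)
  exact memℓp_gen (e.summable_iff.2 this)

/-- Precomposition with a permutation, as a linear isometry of `L2 Γ`. -/
noncomputable def compIsometry {Γ : Type*} (e : Γ ≃ Γ) : L2 Γ →ₗᵢ[ℝ] L2 Γ where
  toFun f := ⟨fun x ↦ f (e x), memlp_comp_equiv e f⟩
  map_add' _ _ := rfl
  map_smul' _ _ := rfl
  norm_map' f := by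
    have h : (0 : ℝ) < (2 : ℝ≥0∞).toReal := by norm_num
    rw [lp.norm_eq_tsum_rpow h, lp.norm_eq_tsum_rpow h]
    congr 1
    exact e.tsum_eq fun x ↦ ‖f x‖ ^ (2 : ℝ≥0∞).toReal

/-- The right regular representation `(π g f) x = f (x * g)`. -/
noncomputable def rightRegular : Γ →* (L2 Γ ≃ₗᵢ[ℝ] L2 Γ) where
  toFun g :=
    { toLinearEquiv := LinearEquiv.ofLinearMap (compIsometry (Equiv.mulRight g)).toLinearMap
        (compIsometry (Equiv.mulRight g⁻¹)).toLinearMap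
        (by ext f x; simp [compIsometry]) (by ext f x; simp [compIsometry])
      norm_map' := (compIsometry (Equiv.mulRight g)).norm_map }
  map_one' := by ext f x; simp [compIsometry]
  map_mul' a b := by
    ext f x
    change f (x * (a * b)) = f (x * a * b)
    rw [mul_assoc]

theorem rightRegular_apply (g : Γ) (f : L2 Γ) (x : Γ) : rightRegular g f x = f (x * g) := rfl

/-- An invariant function is constant, and on an infinite group only the zero constant is summable.
This makes the Laplacian injective. -/
theorem eq_zero_of_rightRegular_eq [Infinite Γ] (f : L2 Γ) (hf : ∀ g, rightRegular g f = f) :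
    f = 0 := by
  have hc : ∀ x, f x = f 1 := fun x ↦ by
    rw [← one_mul x, ← rightRegular_apply, hf]
  have hs := (lp.memℓp f).summable (by norm_num)
  simp only [hc, summable_const_iff] at hs
  ext x
  rw [hc]
  simpa using hs

variable [DecidableEq Γ]

theorem inner_single_rightRegular_single (g x y : Γ) :
    ⟪(lp.single 2 x 1 : L2 Γ), rightRegular g (lp.single 2 y 1)⟫ = if x * g = y then 1 else 0 := by
  rw [lp.inner_single_left, rightRegular_apply, lp.single_apply, Pi.single_apply]
  simp

/-- The function equal to `a` on `K` and to `0` elsewhere. -/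
noncomputable def ofFinset (K : Finset Γ) (a : Γ → ℝ) : L2 Γ := ∑ x ∈ K, a x • lp.single 2 x (1 : ℝ)

theorem inner_ofFinset_rightRegular (K : Finset Γ) (a : Γ → ℝ) (g : Γ) :
    ⟪ofFinset K a, rightRegular g (ofFinset K a)⟫
      = ∑ x ∈ K, ∑ y ∈ K, a x * a y * if x * g = y then 1 else 0 := by
  simp only [ofFinset, map_sum, sum_inner, inner_sum, map_smul, real_inner_smul_left,
    real_inner_smul_right, inner_single_rightRegular_single]
  rw [Finset.sum_comm]
  refine Finset.sum_congr rfl fun x _ ↦ Finset.sum_congr rfl fun y _ ↦ ?_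
  ring

theorem norm_ofFinset_sq (K : Finset Γ) (a : Γ → ℝ) : ‖ofFinset K a‖ ^ 2 = ∑ x ∈ K, a x ^ 2 := by
  have h := inner_ofFinset_rightRegular K a 1
  rw [map_one, LinearIsometryEquiv.coe_one, id, real_inner_self_eq_norm_sq] at h
  rw [h]
  refine Finset.sum_congr rfl fun x hx ↦ ?_
  simp [hx, sq]

/-- A spectral gap bounds the quadratic form of the walk killed outside `K`. -/
theorem sum_sum_mul_le_of_gap {p : Γ → ℝ} (hp : ∀ g, 0 ≤ p g)
    (hp1 : ∀ s : Finset Γ, ∑ g ∈ s, p g ≤ 1) {s : Finset Γ} {δ : ℝ}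
    (hgap : ∀ f : L2 Γ, δ * ‖f‖ ^ 2 ≤ energy rightRegular p s f) (K : Finset Γ)
    (a : Γ → ℝ) :
    ∑ x ∈ K, ∑ y ∈ K, a x * a y * p (x⁻¹ * y) ≤ (1 - δ / 2) * ∑ x ∈ K, a x ^ 2 := by
  set f := ofFinset K a
  -- Adding all increments between points of K makes the sum over t recover the whole quadratic form
  -- on K.
  set t := s ∪ K⁻¹ * K
  have h1 : ∑ x ∈ K, ∑ y ∈ K, a x * a y * p (x⁻¹ * y)
      = ∑ g ∈ t, p g * ⟪f, rightRegular g f⟫ := by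
    simp only [f, inner_ofFinset_rightRegular, Finset.mul_sum]
    rw [Finset.sum_comm]
    conv_rhs => rw [Finset.sum_comm]
    rw [Finset.sum_comm]
    refine Finset.sum_congr rfl fun x hx ↦ ?_
    rw [Finset.sum_comm]
    refine Finset.sum_congr rfl fun y hy ↦ ?_
    rw [Finset.sum_eq_single (x⁻¹ * y)]
    · simp; ring
    · intro g _ hg
      rw [if_neg]
      · simp
      · rintro rfl; simp at hg
    · intro h
      exact absurd (Finset.mem_union_right _ (Finset.mul_mem_mul (Finset.inv_mem_inv hx) hy)) h
  have h2 : energy rightRegular p t f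
      = 2 * ((∑ g ∈ t, p g) * ‖f‖ ^ 2 - ∑ g ∈ t, p g * ⟪f, rightRegular g f⟫) := by
    rw [energy, Finset.sum_mul, ← Finset.sum_sub_distrib, Finset.mul_sum]
    refine Finset.sum_congr rfl fun g _ ↦ ?_
    rw [norm_sub_sq_real, LinearIsometryEquiv.norm_map, real_inner_comm]
    ring
  have h3 := energy_mono (π := rightRegular) hp (Finset.subset_union_left : s ⊆ t) f
  have h4 := mul_le_mul_of_nonneg_right (hp1 t) (sq_nonneg ‖f‖)
  rw [h1, ← norm_ofFinset_sq]
  linarith [hgap f]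

/-- Polarisation: the gap bounds the form B only from above, but p ≥ 0 gives -B(d, d) ≤ B(|d|, |d|)
for d = a - b. -/
theorem sum_sum_mul_le_of_gap_of_symm {p : Γ → ℝ} (hp : ∀ g, 0 ≤ p g)
    (hp1 : ∀ s : Finset Γ, ∑ g ∈ s, p g ≤ 1) (hsymm : ∀ g, p g⁻¹ = p g) {s : Finset Γ} {δ : ℝ}
    (hgap : ∀ f : L2 Γ, δ * ‖f‖ ^ 2 ≤ energy rightRegular p s f) (K : Finset Γ)
    (a b : Γ → ℝ) :
    2 * ∑ x ∈ K, ∑ y ∈ K, a x * b y * p (x⁻¹ * y)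
      ≤ (1 - δ / 2) * (∑ x ∈ K, a x ^ 2 + ∑ x ∈ K, b x ^ 2) := by
  have h1 := sum_sum_mul_le_of_gap hp hp1 hgap K fun x ↦ a x + b x
  have h2 := sum_sum_mul_le_of_gap hp hp1 hgap K fun x ↦ |a x - b x|
  have h3 : ∑ x ∈ K, ∑ y ∈ K, b x * a y * p (x⁻¹ * y)
      = ∑ x ∈ K, ∑ y ∈ K, a x * b y * p (x⁻¹ * y) := by
    rw [Finset.sum_comm]
    refine Finset.sum_congr rfl fun x _ ↦ Finset.sum_congr rfl fun y _ ↦ ?_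
    rw [← hsymm (x⁻¹ * y)]
    simp [mul_comm]
  have h4 : ∑ x ∈ K, ∑ y ∈ K, (-((a x - b x) * (a y - b y))) * p (x⁻¹ * y)
      ≤ ∑ x ∈ K, ∑ y ∈ K, |a x - b x| * |a y - b y| * p (x⁻¹ * y) := by
    gcongr with x _ y _
    · exact hp _
    · rw [← abs_mul]; exact neg_le_abs _
  have h5 : ∑ x ∈ K, ∑ y ∈ K, (a x + b x) * (a y + b y) * p (x⁻¹ * y)
      + ∑ x ∈ K, ∑ y ∈ K, (-((a x - b x) * (a y - b y))) * p (x⁻¹ * y)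
      = 2 * ∑ x ∈ K, ∑ y ∈ K, b x * a y * p (x⁻¹ * y)
        + 2 * ∑ x ∈ K, ∑ y ∈ K, a x * b y * p (x⁻¹ * y) := by
    simp only [Finset.mul_sum, ← Finset.sum_add_distrib]
    refine Finset.sum_congr rfl fun x _ ↦ Finset.sum_congr rfl fun y _ ↦ ?_
    ring
  have h6 : ∑ x ∈ K, (a x + b x) ^ 2 + ∑ x ∈ K, |a x - b x| ^ 2
      = 2 * (∑ x ∈ K, a x ^ 2 + ∑ x ∈ K, b x ^ 2) := by
    simp only [Finset.mul_sum, ← Finset.sum_add_distrib, sq_abs]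
    refine Finset.sum_congr rfl fun x _ ↦ ?_
    ring
  have h7 : (1 - δ / 2) * ∑ x ∈ K, (a x + b x) ^ 2 + (1 - δ / 2) * ∑ x ∈ K, |a x - b x| ^ 2
      = 2 * ((1 - δ / 2) * (∑ x ∈ K, a x ^ 2 + ∑ x ∈ K, b x ^ 2)) := by
    rw [← mul_add, h6]; ring
  linarith

end RegularRepresentation

/-! ### Lifetime of the killed walk -/

section KilledWalk

variable {Γ : Type*} [Group Γ] {p : Γ → ℝ}

/-- `q t x` is dominated by the distribution at time `t` of a walk with step distribution `p`
which is killed outside `K`. -/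
structure IsKilledWalk (p : Γ → ℝ) (K : Finset Γ) (q : ℕ → Γ → ℝ) : Prop where
  nonneg : ∀ t x, 0 ≤ q t x
  sum_zero_le : ∑ x ∈ K, q 0 x ≤ 1
  step_le : ∀ t, ∀ x ∈ K, q (t + 1) x ≤ ∑ y ∈ K, q t y * p (y⁻¹ * x)

theorem IsKilledWalk.sum_mul_succ_le {K : Finset Γ} {q : ℕ → Γ → ℝ} (hq : IsKilledWalk p K q)
    {h : Γ → ℝ} (hh : ∀ x ∈ K, 0 ≤ h x) (t : ℕ) :
    ∑ x ∈ K, q (t + 1) x * h x ≤ ∑ y ∈ K, q t y * ∑ x ∈ K, p (y⁻¹ * x) * h x := by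
  calc ∑ x ∈ K, q (t + 1) x * h x ≤ ∑ x ∈ K, (∑ y ∈ K, q t y * p (y⁻¹ * x)) * h x :=
        Finset.sum_le_sum fun x hx ↦ mul_le_mul_of_nonneg_right (hq.step_le t x hx) (hh x hx)
    _ = ∑ y ∈ K, q t y * ∑ x ∈ K, p (y⁻¹ * x) * h x := by
        simp only [Finset.sum_mul, Finset.mul_sum]
        rw [Finset.sum_comm]
        simp only [mul_assoc]

/-- A Lyapunov argument: the mean of h starts at most M, stays nonnegative, and loses e per unit of
surviving mass at each step. -/
theorem IsKilledWalk.lifetime_le_of_superharmonic {K : Finset Γ} {q : ℕ → Γ → ℝ}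
    (hq : IsKilledWalk p K q) {h : Γ → ℝ} {M e : ℝ} (hM : 0 ≤ M) (h0 : ∀ x ∈ K, 0 ≤ h x)
    (hhM : ∀ x ∈ K, h x ≤ M) (hstep : ∀ y ∈ K, ∑ x ∈ K, p (y⁻¹ * x) * h x ≤ h y - e) (m : ℕ) :
    e * ∑ t ∈ Finset.range m, ∑ x ∈ K, q t x ≤ M := by
  have hind : ∀ m, e * ∑ t ∈ Finset.range m, ∑ x ∈ K, q t x + ∑ x ∈ K, q m x * h x ≤ M := by
    intro m
    induction m with
    | zero =>
      have := Finset.sum_le_sum fun x hx ↦ mul_le_mul_of_nonneg_left (hhM x hx) (hq.nonneg 0 x)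
      rw [← Finset.sum_mul] at this
      have := mul_le_of_le_one_left hM hq.sum_zero_le
      simp only [Finset.range_zero, Finset.sum_empty, mul_zero, zero_add]
      linarith
    | succ m ih =>
      have h1 := hq.sum_mul_succ_le h0 m
      have h2 := Finset.sum_le_sum fun y hy ↦
        mul_le_mul_of_nonneg_left (hstep y hy) (hq.nonneg m y)
      simp only [mul_sub, Finset.sum_sub_distrib, ← Finset.sum_mul] at h2
      rw [Finset.sum_range_succ, mul_add]
      linarith
  linarith [hind m, Finset.sum_nonneg fun x hx ↦ mul_nonneg (hq.nonneg m x) (h0 x hx)]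

variable [DecidableEq Γ]

/-- Summation over the translate `y⁻¹ * K`. -/
theorem sum_translate_le {K s : Finset Γ} {F : Γ → ℝ} {y : Γ} (hK : ∀ x ∈ K, y⁻¹ * x ∈ s)
    (hF : ∀ g ∈ s, 0 ≤ F g) : ∑ x ∈ K, F (y⁻¹ * x) ≤ ∑ g ∈ s, F g := by
  rw [← Finset.sum_image (s := K) (g := fun x ↦ y⁻¹ * x) (f := F) (by intro; simp)]
  refine Finset.sum_le_sum_of_subset_of_nonneg ?_ fun g hg _ ↦ hF g hg
  intro g hg
  obtain ⟨x, hx, rfl⟩ := Finset.mem_image.1 hg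
  exact hK x hx

theorem IsKilledWalk.sum_le_one (hp : ∀ g, 0 ≤ p g) (hp1 : ∀ s : Finset Γ, ∑ g ∈ s, p g ≤ 1)
    {K : Finset Γ} {q : ℕ → Γ → ℝ} (hq : IsKilledWalk p K q) (t : ℕ) :
    ∑ x ∈ K, q t x ≤ 1 := by
  induction t with
  | zero => exact hq.sum_zero_le
  | succ t ih =>
    refine le_trans ?_ ih
    have := hq.sum_mul_succ_le (h := fun _ ↦ 1) (fun _ _ ↦ zero_le_one) t
    simp only [mul_one] at this
    refine this.trans (Finset.sum_le_sum fun y _ ↦ mul_le_of_le_one_right (hq.nonneg t y) ?_)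
    refine (sum_translate_le (F := p) (s := K.image (y⁻¹ * ·)) ?_ fun g _ ↦ hp g).trans (hp1 _)
    exact fun x hx ↦ Finset.mem_image_of_mem _ hx

theorem IsKilledWalk.sum_sq_le_of_gap (hp : ∀ g, 0 ≤ p g)
    (hp1 : ∀ s : Finset Γ, ∑ g ∈ s, p g ≤ 1) (hsymm : ∀ g, p g⁻¹ = p g) {s : Finset Γ} {δ : ℝ}
    (hδ : 0 < δ) (hδ1 : δ ≤ 1)
    (hgap : ∀ f : L2 Γ, δ * ‖f‖ ^ 2 ≤ energy rightRegular p s f) {K : Finset Γ} {q : ℕ → Γ → ℝ}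
    (hq : IsKilledWalk p K q) (t : ℕ) :
    ∑ x ∈ K, q t x ^ 2 ≤ ((1 - δ / 2) / (1 + δ / 2)) ^ t := by
  induction t with
  | zero =>
    rw [pow_zero]
    refine le_trans (Finset.sum_le_sum fun x hx ↦ ?_) hq.sum_zero_le
    have := (Finset.single_le_sum (fun x _ ↦ hq.nonneg 0 x) hx).trans hq.sum_zero_le
    nlinarith [hq.nonneg 0 x]
  | succ t ih =>
    -- Pairing consecutive times gives 2‖q (t+1)‖² ≤ (1 - δ/2)(‖q t‖² + ‖q (t+1)‖²), hence the
    -- stated ratio.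
    have h1 := sum_sum_mul_le_of_gap_of_symm hp hp1 hsymm hgap K (q t) (q (t + 1))
    have h2 := hq.sum_mul_succ_le (h := q (t + 1)) (fun x _ ↦ hq.nonneg _ x) t
    have h3 : ∑ y ∈ K, q t y * ∑ x ∈ K, p (y⁻¹ * x) * q (t + 1) x
        = ∑ x ∈ K, ∑ y ∈ K, q t x * q (t + 1) y * p (x⁻¹ * y) := by
      simp only [Finset.mul_sum]
      refine Finset.sum_congr rfl fun x _ ↦ Finset.sum_congr rfl fun y _ ↦ ?_
      ring
    rw [h3] at h2
    simp only [← sq] at h2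
    rw [pow_succ, mul_div_assoc', le_div_iff₀ (by positivity)]
    have h4 : 0 ≤ 1 - δ / 2 := by linarith
    nlinarith [mul_le_mul_of_nonneg_right ih h4]

/-- In the presence of a spectral gap the expected lifetime in the `n`-ball is even linear. -/
theorem exists_lifetime_le_of_gap (hp : ∀ g, 0 ≤ p g) (hp1 : ∀ s : Finset Γ, ∑ g ∈ s, p g ≤ 1)
    (hsymm : ∀ g, p g⁻¹ = p g) {T s : Finset Γ} {δ : ℝ} (hδ : 0 < δ) (hδ1 : δ ≤ 1)
    (hgap : ∀ f : L2 Γ, δ * ‖f‖ ^ 2 ≤ energy rightRegular p s f) :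
    ∃ c : ℝ, 0 < c ∧ ∀ n : ℕ, 1 ≤ n → ∀ q, IsKilledWalk p (T ^ n) q →
      ∀ m, ∑ t ∈ Finset.range m, ∑ x ∈ T ^ n, q t x ≤ c * (n : ℝ) ^ 2 := by
  set θ := (1 - δ / 2) / (1 + δ / 2) with hθ
  have hθ0 : 0 ≤ θ := div_nonneg (by linarith) (by linarith)
  have hθ1 : θ < 1 := by rw [hθ, div_lt_one (by linarith)]; linarith
  set ρ := √θ with hρ
  have hρ0 : 0 ≤ ρ := Real.sqrt_nonneg _
  have hρ1 : ρ < 1 := by rw [hρ, Real.sqrt_lt' one_pos]; simpa using hθ1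
  -- From time `j * n` on, the decay beats the volume bound |T|ⁿ.
  obtain ⟨j, hj⟩ : ∃ j : ℕ, (T.card : ℝ) * ρ ^ j ≤ 1 := by
    obtain ⟨j, hj⟩ := exists_pow_lt_of_lt_one (show (0 : ℝ) < 1 / (T.card + 1) by positivity) hρ1
    refine ⟨j, ?_⟩
    rw [lt_div_iff₀ (by positivity)] at hj
    nlinarith [pow_nonneg hρ0 j]
  have hinv : 0 < (1 - ρ)⁻¹ := inv_pos.2 (by linarith)
  refine ⟨j + (1 - ρ)⁻¹, by positivity, fun n hn q hq m ↦ ?_⟩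
  have hdecay : ∀ t, ∑ x ∈ T ^ n, q t x ≤ (T.card : ℝ) ^ n * ρ ^ t := fun t ↦ by
    refine abs_le_of_sq_le_sq' ?_ (by positivity) |>.2
    have h1 := sq_sum_le_card_mul_sum_sq (s := T ^ n) (f := q t)
    have h2 := hq.sum_sq_le_of_gap hp hp1 hsymm hδ hδ1 hgap t
    have h3 : ((T ^ n).card : ℝ) ≤ (T.card : ℝ) ^ n := by exact_mod_cast Finset.card_pow_le
    have h4 : (T.card : ℝ) ^ n ≤ ((T.card : ℝ) ^ n) ^ 2 := by
      exact_mod_cast Nat.le_self_pow two_ne_zero _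
    calc _ ≤ _ := h1
      _ ≤ ((T.card : ℝ) ^ n) ^ 2 * θ ^ t := by
        gcongr
        exact h3.trans h4
      _ = _ := by
        rw [mul_pow, ← pow_mul ρ, mul_comm t, pow_mul, hρ, Real.sq_sqrt hθ0]
  have htail : ∀ t, ∑ x ∈ T ^ n, q (j * n + t) x ≤ ρ ^ t := fun t ↦ by
    refine (hdecay _).trans ?_
    rw [pow_add, pow_mul, ← mul_assoc, ← mul_pow]
    exact mul_le_of_le_one_left (by positivity) (pow_le_one₀ (by positivity) hj)
  have hn' : (1 : ℝ) ≤ n := by exact_mod_cast hn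
  calc ∑ t ∈ Finset.range m, ∑ x ∈ T ^ n, q t x
      ≤ ∑ t ∈ Finset.range (j * n + m), ∑ x ∈ T ^ n, q t x := by
        refine Finset.sum_le_sum_of_subset_of_nonneg (Finset.range_mono (by omega)) ?_
        exact fun t _ _ ↦ Finset.sum_nonneg fun x _ ↦ hq.nonneg t x
    _ ≤ ∑ t ∈ Finset.range (j * n), (1 : ℝ) + ∑ t ∈ Finset.range m, ρ ^ t := by
        rw [Finset.sum_range_add]
        gcongr with t _ t _
        · exact hq.sum_le_one hp hp1 t
        · exact htail t
    _ ≤ j * n + (1 - ρ)⁻¹ := by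
        have := (summable_geometric_of_lt_one hρ0 hρ1).sum_le_tsum (Finset.range m)
          fun t _ ↦ pow_nonneg hρ0 t
        rw [tsum_geometric_of_lt_one hρ0 hρ1] at this
        simpa using this
    _ ≤ (j + (1 - ρ)⁻¹) * (n : ℝ) ^ 2 := by
        have h1 : (n : ℝ) ≤ (n : ℝ) ^ 2 := by nlinarith
        have h2 : (1 : ℝ) ≤ (n : ℝ) ^ 2 := by nlinarith
        have h3 := mul_le_mul_of_nonneg_left h1 (Nat.cast_nonneg (α := ℝ) j)
        have h4 := mul_le_mul_of_nonneg_left h2 hinv.le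
        linarith

theorem exists_lifetime_le_of_no_gap [Infinite Γ] (hp : ∀ g, 0 ≤ p g)
    (hp1 : ∀ s : Finset Γ, ∑ g ∈ s, p g ≤ 1) (hsymm : ∀ g, p g⁻¹ = p g)
    (hgen : Subgroup.closure {g | p g ≠ 0} = ⊤) {T : Finset Γ} (h1 : 1 ∈ T) (hinv : T⁻¹ = T)
    (hT : ∀ g, ∃ n : ℕ, g ∈ T ^ n)
    (hgap : ∀ k : ℕ, ∀ δ > 0, ∃ f : L2 Γ, energy rightRegular p (T ^ k) f < δ * ‖f‖ ^ 2) :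
    ∃ c : ℝ, 0 < c ∧ ∀ n : ℕ, 1 ≤ n → ∀ q, IsKilledWalk p (T ^ n) q →
      ∀ m, ∑ t ∈ Finset.range m, ∑ x ∈ T ^ n, q t x ≤ c * (n : ℝ) ^ 2 := by
  obtain ⟨C, hC, N, hN⟩ :=
    exists_forall_norm_map_sub_le_sqrt_energy (π := rightRegular) h1 hT hp hgen
  refine ⟨2 * ((3 + N) * C) ^ 2, by positivity, fun n hn q hq m ↦ ?_⟩
  have hn' : (1 : ℝ) ≤ n := by exact_mod_cast hn
  -- `2 * n` covers all increments between points of `T ^ n`; `N` makes the Lipschitz constant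
  -- available.
  set k := 2 * n + N with hk
  have hLip : ∀ (f : L2 Γ) (i : ℕ), ∀ g ∈ T ^ i,
      ‖rightRegular g f - f‖ ≤ i * (C * √(energy rightRegular p (T ^ k) f)) := fun f i ↦
    norm_map_sub_le_of_mem_pow (hN k (by omega) f) i
  obtain ⟨f, hf0, hf⟩ := exists_norm_sq_le_mul_inner
    (laplacian (rightRegular : Γ →* (L2 Γ ≃ₗᵢ[ℝ] L2 Γ)) p (T ^ k))
    (inner_laplacian_comm _ _ hsymm (by rw [← inv_pow, hinv]))
    (fun u ↦ by
      rw [inner_laplacian]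
      exact div_nonneg (energy_nonneg hp _ u) zero_le_two)
    (fun u hu ↦ eq_zero_of_rightRegular_eq u fun g ↦ by
      have hE := inner_laplacian rightRegular p (T ^ k) u
      rw [hu, inner_zero_right, eq_comm, div_eq_zero_iff, or_iff_left two_ne_zero] at hE
      obtain ⟨i, hi⟩ := hT g
      have := hLip u i g hi
      rw [hE] at this
      simpa [sub_eq_zero] using this)
    (fun δ hδ ↦ by
      obtain ⟨u, hu⟩ := hgap k (2 * δ) (by positivity)
      exact ⟨u, by rw [inner_laplacian]; linarith⟩)
    -- Chosen so that ‖Δf‖² ≤ E/(4nC)², the drift condition with D = nC√E.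
    (ε := 2 / (4 * n * C) ^ 2) (by positivity)
  rw [inner_laplacian] at hf0 hf
  set E := energy rightRegular p (T ^ k) f with hE
  have hE0 : 0 < E := by linarith
  have hlap : 4 * (n * (C * √E)) * ‖laplacian rightRegular p (T ^ k) f‖ ≤ E := by
    have h2 : (4 * n * C * ‖laplacian rightRegular p (T ^ k) f‖) ^ 2 ≤ E := by
      rw [mul_pow]
      calc _ ≤ (4 * n * C) ^ 2 * (2 / (4 * n * C) ^ 2 * (E / 2)) := by gcongr
        _ = E := by field_simp
    have h3 := Real.le_sqrt_of_sq_le h2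
    calc _ = √E * (4 * n * C * ‖laplacian rightRegular p (T ^ k) f‖) := by ring
      _ ≤ √E * √E := by gcongr
      _ = E := Real.mul_self_sqrt hE0.le
  -- The radius is n + k, not n, so that M minus the squared displacement is nonnegative wherever a
  -- truncated step from `T ^ n` lands.
  set M := ((n + k : ℕ) * (C * √E)) ^ 2 with hM
  have hbound : ∀ g ∈ T ^ (n + k), 0 ≤ M - ‖rightRegular g f - f‖ ^ 2 := fun g hg ↦ by
    rw [sub_nonneg, hM]
    gcongr
    exact hLip f _ g hg
  have hsub : T ^ n ⊆ T ^ (n + k) := Finset.pow_subset_pow_right h1 (by omega)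
  have hlife := hq.lifetime_le_of_superharmonic (h := fun x ↦ M - ‖rightRegular x f - f‖ ^ 2)
    (M := M) (e := E / 2) (sq_nonneg _) (fun x hx ↦ hbound x (hsub hx))
    (fun x _ ↦ by linarith [sq_nonneg ‖rightRegular x f - f‖]) (fun y hy ↦ ?_) m
  · have hM' : M ≤ ((3 + N) * C) ^ 2 * (n : ℝ) ^ 2 * E := by
      have : ((n + k : ℕ) : ℝ) ≤ (3 + N) * n := by
        rw [hk]; push_cast; nlinarith [(Nat.cast_nonneg N : (0 : ℝ) ≤ N)]
      calc M ≤ ((3 + N) * n * (C * √E)) ^ 2 := by rw [hM]; gcongr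
        _ = ((3 + N) * C) ^ 2 * (n : ℝ) ^ 2 * √E ^ 2 := by ring
        _ = _ := by rw [Real.sq_sqrt hE0.le]
    refine le_of_mul_le_mul_left ?_ hE0
    linarith
  · have hstep := sum_mul_norm_map_sub_sq_ge (hLip f n y hy) hlap
    -- Nonnegativity lets the sum over steps staying in `T ^ n` be enlarged to all of `T ^ k`, where
    -- the drift estimate applies.
    have htrans := sum_translate_le (K := T ^ n) (s := T ^ k) (y := y)
      (F := fun g ↦ p g * (M - ‖rightRegular (y * g) f - f‖ ^ 2)) (fun x hx ↦ ?_) fun g hg ↦ ?_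
    · simp only [mul_inv_cancel_left] at htrans
      refine htrans.trans ?_
      have hy0 := mul_le_of_le_one_left (hbound y (hsub hy)) (hp1 (T ^ k))
      simp only [mul_sub, Finset.sum_sub_distrib, ← Finset.sum_mul] at hy0 ⊢
      linarith
    · refine Finset.pow_subset_pow_right h1 (show n + n ≤ k by omega) ?_
      rw [pow_add]
      refine Finset.mul_mem_mul ?_ hx
      rw [← hinv, inv_pow]
      exact Finset.inv_mem_inv hy
    · refine mul_nonneg (hp g) (hbound _ ?_)
      rw [pow_add]
      exact Finset.mul_mem_mul hy hg

/-- The expected lifetime of a symmetric nondegenerate walk killed outside the ball of radius `n`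
is at most quadratic in `n`. -/
theorem exists_lifetime_le [Infinite Γ] (hp : ∀ g, 0 ≤ p g)
    (hp1 : ∀ s : Finset Γ, ∑ g ∈ s, p g ≤ 1) (hsymm : ∀ g, p g⁻¹ = p g)
    (hgen : Subgroup.closure {g | p g ≠ 0} = ⊤) {T : Finset Γ} (h1 : 1 ∈ T) (hinv : T⁻¹ = T)
    (hT : ∀ g, ∃ n : ℕ, g ∈ T ^ n) :
    ∃ c : ℝ, 0 < c ∧ ∀ n : ℕ, 1 ≤ n → ∀ q, IsKilledWalk p (T ^ n) q →
      ∀ m, ∑ t ∈ Finset.range m, ∑ x ∈ T ^ n, q t x ≤ c * (n : ℝ) ^ 2 := by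
  by_cases hgap : ∀ k : ℕ, ∀ δ > 0, ∃ f : L2 Γ, energy rightRegular p (T ^ k) f < δ * ‖f‖ ^ 2
  · exact exists_lifetime_le_of_no_gap hp hp1 hsymm hgen h1 hinv hT hgap
  · push Not at hgap
    obtain ⟨k, δ, hδ, h⟩ := hgap
    refine exists_lifetime_le_of_gap hp hp1 hsymm (lt_min hδ one_pos) (min_le_right δ 1)
      (s := T ^ k) fun f ↦ le_trans ?_ (h f)
    gcongr
    exact min_le_left _ _

end KilledWalk

/-! ### Graph balls and powers of the generating set -/

section CayleyGraph

variable {Γ : Type*} [Group Γ] {X : Set Γ}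

theorem reachable_mul (hX : Subgroup.closure X = ⊤) (u g : Γ) :
    (SimpleGraph.mulCayley X).Reachable u (u * g) := by
  have hg : g ∈ Subgroup.closure X := hX ▸ Subgroup.mem_top g
  induction hg using Subgroup.closure_induction generalizing u with
  | mem x hx =>
    by_cases h : u = u * x
    · exact h ▸ SimpleGraph.Reachable.refl _
    · exact SimpleGraph.Adj.reachable ((SimpleGraph.mulCayley_adj X _ _).2 ⟨h, Or.inl (by simpa)⟩)
  | one => simp
  | mul a b _ _ iha ihb => rw [← mul_assoc]; exact (iha u).trans (ihb _)
  | inv a _ ih => simpa using (ih (u * a⁻¹)).symm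

theorem inv_mul_mem_pow_length [DecidableEq Γ] {T : Finset Γ} (hT : T⁻¹ = T) (hXT : X ⊆ T)
    {u v : Γ} (w : (SimpleGraph.mulCayley X).Walk u v) : u⁻¹ * v ∈ T ^ w.length := by
  induction w with
  | nil => simp
  | @cons a b c h w ih =>
    rw [SimpleGraph.Walk.length_cons, pow_succ',
      show a⁻¹ * c = (a⁻¹ * b) * (b⁻¹ * c) by group]
    refine Finset.mul_mem_mul ?_ ih
    rcases ((SimpleGraph.mulCayley_adj X _ _).1 h).2 with h | h
    · exact hXT h
    · rw [← hT, Finset.mem_inv']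
      simpa using hXT h

theorem inv_mul_mem_pow_of_mem_ball [DecidableEq Γ] (hX : Subgroup.closure X = ⊤) {T : Finset Γ}
    (h1 : 1 ∈ T) (hT : T⁻¹ = T) (hXT : X ⊆ T) {o v : Γ} {r : ℝ} (hv : v ∈ ball X o r) :
    o⁻¹ * v ∈ T ^ ⌊r⌋₊ := by
  obtain ⟨w, hw⟩ := (by simpa using reachable_mul hX o (o⁻¹ * v) :
    (SimpleGraph.mulCayley X).Reachable o v).exists_walk_length_eq_dist
  exact Finset.pow_subset_pow_right h1 (hw ▸ Nat.le_floor hv) (inv_mul_mem_pow_length hT hXT w)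

theorem exists_mem_pow [DecidableEq Γ] (hX : Subgroup.closure X = ⊤) {T : Finset Γ}
    (hT : T⁻¹ = T) (hXT : X ⊆ T) (g : Γ) : ∃ n : ℕ, g ∈ T ^ n := by
  obtain ⟨w⟩ := (by simpa using reachable_mul hX 1 g :
    (SimpleGraph.mulCayley X).Reachable 1 g)
  exact ⟨_, by simpa using inv_mul_mem_pow_length hT hXT w⟩

theorem countable_of_forall_mem_pow [DecidableEq Γ] {T : Finset Γ}
    (hT : ∀ g, ∃ n : ℕ, g ∈ T ^ n) : Countable Γ := by
  rw [← Set.countable_univ_iff, show (Set.univ : Set Γ) = ⋃ n : ℕ, ((T ^ n : Finset Γ) : Set Γ) from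
    (Set.eq_univ_of_forall fun g ↦ Set.mem_iUnion.2 (hT g)).symm]
  exact Set.countable_iUnion fun n ↦ Finset.countable_toSet _

end CayleyGraph

/-! ### The random walk as a killed walk -/

section RandomWalk

variable {Γ Ω : Type*} [Group Γ] {S : ℕ → Ω → Γ}

/-- The walk translated to start at `1`. -/
def normalized (S : ℕ → Ω → Γ) (t : ℕ) (ω : Ω) : Γ := (S 0 ω)⁻¹ * S t ω

/-- The walk stays in `K` up to time `t`, where it is at `x`. -/
def pathEvent (S : ℕ → Ω → Γ) (K : Finset Γ) (t : ℕ) (x : Γ) : Set Ω :=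
  {ω | (∀ s ≤ t, normalized S s ω ∈ K) ∧ normalized S t ω = x}

theorem normalized_succ (t : ℕ) (ω : Ω) :
    normalized S (t + 1) ω = normalized S t ω * increment S t ω := by
  simp [normalized, increment, mul_assoc]

variable [MeasurableSpace Γ]

theorem IsRandomWalk.measure_forall_mem_le [MeasurableSpace Ω] {P : Measure Ω} {o : Γ}
    [IsProbabilityMeasure P] (hS : IsRandomWalk P S o)
    {B : Set Γ} {K : Finset Γ} (hB : ∀ v ∈ B, o⁻¹ * v ∈ K) (t : ℕ) :
    P {ω | ∀ s ≤ t, S s ω ∈ B} ≤ ENNReal.ofReal (∑ x ∈ K, P.real (pathEvent S K t x)) := by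
  rw [← ENNReal.ofReal_toReal (measure_ne_top P {ω | ∀ s ≤ t, S s ω ∈ B})]
  refine ENNReal.ofReal_le_ofReal (le_trans ?_ (measureReal_biUnion_finset_le K _))
  refine ENNReal.toReal_mono (measure_ne_top _ _) (measure_mono_ae ?_)
  filter_upwards [hS.start] with ω h0 hω
  have hK : ∀ s ≤ t, normalized S s ω ∈ K := fun s hs ↦ by
    rw [normalized, h0]; exact hB _ (hω s hs)
  exact Set.mem_iUnion₂.2 ⟨normalized S t ω, hK t le_rfl, hK, rfl⟩

variable [DiscreteMeasurableSpace Γ] [Countable Γ]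

/-- The σ-algebra is arbitrary so that it can be the one generated by the increments before t, as
independence of the next step requires. -/
theorem measurable_normalized {m : MeasurableSpace Ω} {t : ℕ}
    (hm : ∀ i < t, Measurable[m] (increment S i)) (s : ℕ) (hs : s ≤ t) :
    Measurable[m] (normalized S s) := by
  induction s with
  | zero =>
    have : normalized S 0 = fun _ ↦ 1 := by ext ω; simp [normalized]
    rw [this]
    exact measurable_const
  | succ s ih =>
    have : normalized S (s + 1)
        = (fun z : Γ × Γ ↦ z.1 * z.2) ∘ fun ω ↦ (normalized S s ω, increment S s ω) := by
      ext ω; exact normalized_succ s ω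
    rw [this]
    exact Measurable.of_discrete.comp ((ih (by omega)).prodMk (hm s (by omega)))

theorem measurableSet_pathEvent {m : MeasurableSpace Ω} {t : ℕ}
    (hm : ∀ i < t, Measurable[m] (increment S i)) (K : Finset Γ) (x : Γ) :
    MeasurableSet[m] (pathEvent S K t x) := by
  have : pathEvent S K t x
      = (⋂ s, ⋂ (_ : s ≤ t), normalized S s ⁻¹' K) ∩ normalized S t ⁻¹' {x} := by
    ext ω; simp [pathEvent]
  rw [this]
  refine MeasurableSet.inter (MeasurableSet.iInter fun s ↦ MeasurableSet.iInter fun hs ↦ ?_) ?_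
  · exact measurable_normalized hm s hs .of_discrete
  · exact measurable_normalized hm t le_rfl .of_discrete

variable [MeasurableSpace Ω] {P : Measure Ω} {o : Γ}

theorem IsRandomWalk.measurable_increment (hS : IsRandomWalk P S o) (t : ℕ) :
    Measurable (increment S t) :=
  (Measurable.of_discrete (f := fun z : Γ × Γ ↦ z.1⁻¹ * z.2)).comp
    ((hS.measurable t).prodMk (hS.measurable (t + 1)))

theorem IsRandomWalk.measure_pathEvent_inter (hS : IsRandomWalk P S o) (K : Finset Γ)
    (t : ℕ) (x g : Γ) :
    P.real (pathEvent S K t x ∩ {ω | increment S t ω = g})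
      = P.real (pathEvent S K t x) * P.real {ω | increment S 0 ω = g} := by
  have hind := indep_iSup_of_disjoint (fun i ↦ (hS.measurable_increment i).comap_le)
    hS.indep.iIndep (S := Set.Iio t) (T := {t}) (by simp)
  have hmeas : P {ω | increment S t ω = g} = P {ω | increment S 0 ω = g} :=
    (hS.identDistrib t).measure_mem_eq (s := {g}) .of_discrete
  have h := (Indep_iff _ _ _).1 hind (pathEvent S K t x) {ω | increment S t ω = g}
    (measurableSet_pathEvent (fun i hi ↦ ?_) K x) ?_
  · simp only [Measure.real, h, hmeas, ENNReal.toReal_mul]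
  · exact (comap_measurable (increment S i)).mono
      (le_iSup₂_of_le (f := fun i (_ : i ∈ Set.Iio t) ↦ MeasurableSpace.comap (increment S i) _)
        i hi le_rfl) le_rfl
  · exact le_iSup₂_of_le (f := fun i (_ : i ∈ ({t} : Set ℕ)) ↦
      MeasurableSpace.comap (increment S i) _) t rfl le_rfl _ ⟨{g}, .of_discrete, rfl⟩

theorem IsRandomWalk.isKilledWalk [IsProbabilityMeasure P] (hS : IsRandomWalk P S o)
    (K : Finset Γ) :
    IsKilledWalk (fun g ↦ P.real {ω | increment S 0 ω = g}) K
      fun t x ↦ P.real (pathEvent S K t x) where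
  nonneg _ _ := measureReal_nonneg
  sum_zero_le := by
    classical
    calc ∑ x ∈ K, P.real (pathEvent S K 0 x) ≤ ∑ x ∈ K, if 1 = x then 1 else 0 := by
          refine Finset.sum_le_sum fun x _ ↦ ?_
          split_ifs with h
          · exact measureReal_le_one
          · have : pathEvent S K 0 x = ∅ := by ext ω; simp [pathEvent, normalized, h]
            simp [this]
      _ ≤ 1 := by rw [Finset.sum_ite_eq]; split_ifs <;> norm_num
  step_le t x _ := by
    simp only [← hS.measure_pathEvent_inter]
    refine (measureReal_mono ?_ (measure_ne_top _ _)).trans (measureReal_biUnion_finset_le K _)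
    rintro ω ⟨hK, hx⟩
    refine Set.mem_iUnion₂.2 ⟨normalized S t ω, hK t (by omega),
      ⟨fun s hs ↦ hK s (by omega), rfl⟩, ?_⟩
    simp [← hx, normalized_succ]

theorem sum_measureReal_increment_le_one [IsProbabilityMeasure P] (hS : IsRandomWalk P S o)
    (s : Finset Γ) : ∑ g ∈ s, P.real {ω | increment S 0 ω = g} ≤ 1 :=
  (sum_measureReal_preimage_singleton (f := increment S 0) s
    fun _ _ ↦ hS.measurable_increment 0 .of_discrete).trans_le measureReal_le_one

end RandomWalk

/-! ### Expected exit time and survival probabilities -/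

theorem toENNReal_le_tsum {a : ℕ∞} {F : ℕ → ℝ≥0∞} (h : ∀ t : ℕ, (t : ℕ∞) < a → 1 ≤ F t) :
    (a : ℝ≥0∞) ≤ ∑' t, F t := by
  have key : ∀ n : ℕ, (n : ℕ∞) ≤ a → (n : ℝ≥0∞) ≤ ∑' t, F t := fun n hn ↦ by
    calc (n : ℝ≥0∞) = ∑ t ∈ Finset.range n, 1 := by simp
      _ ≤ ∑ t ∈ Finset.range n, F t := Finset.sum_le_sum fun t ht ↦
          h t (lt_of_lt_of_le (by exact_mod_cast Finset.mem_range.1 ht) hn)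
      _ ≤ ∑' t, F t := ENNReal.sum_le_tsum _
  induction a with
  | top => exact (ENNReal.eq_top_of_forall_nnreal_le fun r ↦
      le_trans (by exact_mod_cast Nat.le_ceil r) (key ⌈r⌉₊ le_top)).ge
  | coe n => simpa using key n le_rfl

theorem lintegral_exitTime_le {Γ Ω : Type*} [Group Γ] [MeasurableSpace Γ]
    [DiscreteMeasurableSpace Γ] [MeasurableSpace Ω] {P : Measure Ω} (X : Set Γ) {S : ℕ → Ω → Γ}
    (hS : ∀ t, Measurable (S t)) (o : Γ) (r : ℝ) :
    ∫⁻ ω, (exitTime X S o r ω : ℝ≥0∞) ∂P ≤ ∑' t, P {ω | ∀ s ≤ t, S s ω ∈ ball X o r} := by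
  have hmeas : ∀ t : ℕ, MeasurableSet {ω | ∀ s ≤ t, S s ω ∈ ball X o r} := fun t ↦ by
    simp only [Set.ofPred_forall]
    exact MeasurableSet.iInter fun s ↦ MeasurableSet.iInter fun _ ↦ hS s .of_discrete
  simp only [← lintegral_indicator_one (hmeas _)]
  rw [← lintegral_tsum fun t ↦ (measurable_one.indicator (hmeas t)).aemeasurable]
  refine lintegral_mono fun ω ↦ toENNReal_le_tsum fun t ht ↦ ?_
  rw [Set.indicator_of_mem, Pi.one_apply]
  intro s hs
  have := notMem_of_lt_hittingAfter (u := S) (s := (ball X o r)ᶜ) (n := 0) (ω := ω) (k := s)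
    (lt_of_le_of_lt (WithTop.coe_le_coe.2 hs) ht) (Nat.zero_le s)
  simpa using this

end CayleyWalk

open scoped Pointwise in
theorem theorem2p2 {Γ : Type*} [Group Γ] [Infinite Γ]
    [MeasurableSpace Γ] [DiscreteMeasurableSpace Γ]
    (X : Set Γ) (hX : X.Finite) (hXgen : Subgroup.closure X = ⊤)
    {Ω : Type*} [MeasurableSpace Ω] (P : Measure Ω) [IsProbabilityMeasure P]
    (S : ℕ → Ω → Γ) (o : Γ)
    (hS : CayleyWalk.IsRandomWalk P S o)
    (hsymm : CayleyWalk.IsSymmetric P S)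
    (hgen : Subgroup.closure (CayleyWalk.stepSupport P S) = ⊤) :
    ∃ c : ℝ, 0 < c ∧ ∀ r : ℝ, 1 ≤ r →
      ∫⁻ ω, (CayleyWalk.exitTime X S o r ω : ℝ≥0∞) ∂P ≤ ENNReal.ofReal (c * r ^ 2) := by
  classical
  -- Inverses give closure under inversion; 1 makes the powers of T increasing.
  set T : Finset Γ := insert 1 (hX.toFinset ∪ hX.toFinset⁻¹)
  have h1 : 1 ∈ T := Finset.mem_insert_self _ _
  have hinv : T⁻¹ = T := by
    ext g
    simp [T, or_comm]
  have hXT : X ⊆ T := fun x hx ↦ by simp [T, hx]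
  have hT := CayleyWalk.exists_mem_pow hXgen hinv hXT
  have : Countable Γ := CayleyWalk.countable_of_forall_mem_pow hT
  obtain ⟨c, hc, h⟩ := CayleyWalk.exists_lifetime_le
    (p := fun g ↦ P.real {ω | CayleyWalk.increment S 0 ω = g}) (fun _ ↦ measureReal_nonneg)
    (CayleyWalk.sum_measureReal_increment_le_one hS)
    (fun g ↦ by simp only [Measure.real, ← hsymm g])
    (by
      rw [← hgen]
      congr 1
      ext g
      simp [CayleyWalk.stepSupport, measureReal_eq_zero_iff]) h1 hinv hT
  refine ⟨c, hc, fun r hr ↦ (CayleyWalk.lintegral_exitTime_le X hS.measurable o r).trans ?_⟩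
  refine ENNReal.tsum_le_of_sum_range_le fun m ↦ ?_
  refine (Finset.sum_le_sum fun t _ ↦ hS.measure_forall_mem_le (K := T ^ ⌊r⌋₊)
    (fun v hv ↦ CayleyWalk.inv_mul_mem_pow_of_mem_ball hXgen h1 hinv hXT hv) t).trans ?_
  rw [← ENNReal.ofReal_sum_of_nonneg fun t _ ↦ Finset.sum_nonneg fun x _ ↦ measureReal_nonneg]
  refine ENNReal.ofReal_le_ofReal
    ((h _ ((Nat.one_le_floor_iff r).2 hr) _ (hS.isKilledWalk _) m).trans ?_)
  gcongr
  exact Nat.floor_le (by linarith)
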